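/- Let $n\ge 2$ and let $D\subset\mathbb C^n$ be a convex domain (non-empty open convex set) that is non-degenerate, i.e. contains no complex affine line. Let $\mathbb B^n$ be the Euclidean unit ball of $\mathbb C^n$, let $\mathcal O(U,V)$ denote the holomorphic maps $U\to V$, and for $z\in D$ define the Carathéodory and Kobayashi–Eisenman volume elements $$c_D(z)=\sup\{|\det\psi'(z)|^2:\psi\in\mathcal O(D,\mathbb B^n),\ \psi(z)=0\},\qquad k_D(z)=\inf\{|\det\psi'(0)|^{-2}:\psi\in\mathcal O(\mathbb B^n,D),\ \psi(0)=z\},$$ where $\det\psi'$ is the complex Jacobian determinant and $|\det\psi'(0)|^{-2}=+\infty$ if $\det\psi'(0)=0$. Let $A^2(D)$ be the space of holomorphic functions on $D$ that are square integrable for Lebesgue measure $dV$. Then $A^2(D)$ has a reproducing kernel $K_D(z,w)$ (the Bergman kernel: $K_D(\cdot,w)\in A^2(D)$ and $f(w)=\int_D f(z)\overline{K_D(z,w)}\,dV(z)$ for all $f\in A^2(D)$, $w\in D$), and, writing $K_D(z)=K_D(z,z)$, for every $z\in D$ and for both $v_D=c_D$ and $v_D=k_D$, $$\frac{\pi^n}{(2n)!\,(2n)^n}\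 \le\ \frac{v_D(z)}{K_D(z)}\ \le\ \left(\frac{4\pi(4^n-1)}{3}\right)^n .$$ In particular $c_D(z)$, $k_D(z)$ and $K_D(z)$ are positive and finite. -/

import Mathlib

open MeasureTheory
open scoped ENNReal ComplexConjugate

noncomputable section

/-- `ℂⁿ` with its Hermitian (Euclidean) norm; its `volume` is Lebesgue measure on `ℝ²ⁿ`. -/
abbrev CSpace (n : ℕ) : Type := EuclideanSpace ℂ (Fin n)

/-- `D` contains no complex (affine) line. -/
def NonDegenerate {n : ℕ} (D : Set (CSpace n)) : Prop :=
  ¬ ∃ p v : CSpace n, v ≠ 0 ∧ ∀ t : ℂ, p + t • v ∈ D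

/-- Holomorphic maps from the open set `U` into `V`; only the values on `U` matter. -/
def HolMaps {n : ℕ} (U V : Set (CSpace n)) : Set (CSpace n → CSpace n) :=
  {ψ | DifferentiableOn ℂ ψ U ∧ Set.MapsTo ψ U V}

/-- The Carathéodory volume element: the supremum of `|det ψ'(z)|²` over holomorphic
`ψ : D → 𝔹ⁿ` with `ψ z = 0`. -/
def caratheodoryVol {n : ℕ} (D : Set (CSpace n)) (z : CSpace n) : ℝ≥0∞ :=
  ⨆ ψ ∈ {ψ ∈ HolMaps D (Metric.ball 0 1) | ψ z = 0}, ‖(fderiv ℂ ψ z).det‖ₑ ^ 2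

/-- The Kobayashi–Eisenman volume element: the infimum of `|det ψ'(0)|⁻²` over holomorphic
`ψ : 𝔹ⁿ → D` with `ψ 0 = z`; in `ℝ≥0∞` a vanishing determinant contributes `∞`. -/
def kobayashiVol {n : ℕ} (D : Set (CSpace n)) (z : CSpace n) : ℝ≥0∞ :=
  ⨅ ψ ∈ {ψ ∈ HolMaps (Metric.ball 0 1) D | ψ 0 = z}, (‖(fderiv ℂ ψ 0).det‖ₑ ^ 2)⁻¹

/-- The Bergman space `A²(D)`: holomorphic functions on `D` that are square integrable on `D`. -/
def bergmanSpace {n : ℕ} (D : Set (CSpace n)) : Set (CSpace n → ℂ) :=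
  {f | DifferentiableOn ℂ f D ∧ MemLp f 2 (volume.restrict D)}

/-- `K` is a reproducing kernel of `A²(D)`. For open `D` this determines `K` on `D × D`. -/
def IsBergmanKernel {n : ℕ} (D : Set (CSpace n)) (K : CSpace n → CSpace n → ℂ) : Prop :=
  ∀ w ∈ D, (fun z => K z w) ∈ bergmanSpace D ∧
    ∀ f ∈ bergmanSpace D, f w = ∫ z in D, f z * conj (K z w)

/-- The Bergman kernel `K_D(z, w)`. -/
def bergmanKernel {n : ℕ} (D : Set (CSpace n)) : CSpace n → CSpace n → ℂ :=
  Classical.epsilon (IsBergmanKernel D)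

/-- The Bergman kernel on the diagonal, `K_D(z) = K_D(z, z)`, a nonnegative real number. -/
def bergmanDiag {n : ℕ} (D : Set (CSpace n)) (z : CSpace n) : ℝ :=
  (bergmanKernel D z z).re

end

/-! Around `z`, the domain is squeezed between two linear models: it contains `z + U(B)`, with `B`
the complex `ℓ¹` unit ball, and it lies in the region where every coordinate of `Λ (x - z)` has real
part below `1`, with `det Λ * det U = 1`. Both maps come from one triangular system of maximal discs
and supporting functionals (`exists_inner_and_outer_linear_maps`).

Each model bounds all invariants in terms of `a = |det U|²`. The inner one gives `K ≤ (2n)! / ((2π)ⁿ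
a)`, by the mean value property on a balanced set, and `k ≤ nⁿ / a`. The outer one is carried into
the unit polydisc by a coordinatewise Cayley map with derivative `1/2` at the centre, so `K ≥ 1 /
((4π)ⁿ a)` and `c ≥ 1 / ((4n)ⁿ a)`. Since `c ≤ k` by the Schwarz lemma, `a` cancels in the
quotients. The upper constant obtained is `(4πn)ⁿ`, and `n ≤ (4ⁿ - 1)/3`. -/

/-! ### Lebesgue volumes of the model sets -/

/-- Both are Haar measures, so one set decides: the parallelepiped of the orthonormal basis `1, i`
in each coordinate pulls back to a product of unit squares, of mass `1`. -/
theorem EuclideanSpace.volume_preserving_toLp_complex (ι : Type*) [Fintype ι] :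
    MeasurePreserving (WithLp.toLp 2 : (ι → ℂ) → EuclideanSpace ℂ ι) := by
  classical
  let b : OrthonormalBasis ((_ : ι) × Fin 2) ℝ (EuclideanSpace ℂ ι) :=
    Pi.orthonormalBasis fun _ => Complex.orthonormalBasisOneI
  let e : (ι → ℂ) ≃L[ℝ] EuclideanSpace ℂ ι :=
    (PiLp.continuousLinearEquiv 2 ℝ (fun _ : ι => ℂ)).symm
  have he : (e : (ι → ℂ) → EuclideanSpace ℂ ι) = WithLp.toLp 2 := rfl
  refine ⟨e.continuous.measurable, ?_⟩
  rw [← he]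
  have hH : (Measure.map e (volume : Measure (ι → ℂ))).IsAddHaarMeasure :=
    e.isAddHaarMeasure_map _
  rw [← b.addHaar_eq_volume]
  symm
  rw [Module.Basis.addHaar_eq_iff]
  have hset : e ⁻¹' (b.toBasis.parallelepiped : Set (EuclideanSpace ℂ ι)) =
      Set.pi Set.univ fun _ => parallelepiped Complex.orthonormalBasisOneI := by
    ext x
    simp only [Set.mem_preimage, Module.Basis.coe_parallelepiped, mem_parallelepiped_iff,
      Set.mem_pi, Set.mem_univ, true_imp_iff, OrthonormalBasis.coe_toBasis]
    have key (t : ((_ : ι) × Fin 2) → ℝ) (i : ι) :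
        (∑ p, t p • b p) i = ∑ k, t ⟨i, k⟩ • Complex.orthonormalBasisOneI k := by
      rw [WithLp.ofLp_sum, Finset.sum_apply, Fintype.sum_sigma, Finset.sum_eq_single i]
      · simp [b, Pi.orthonormalBasis_apply]
      · intro j _ hj
        simp [b, Pi.orthonormalBasis_apply, hj.symm]
      · simp
    constructor
    · rintro ⟨t, ht, hx⟩ i
      refine ⟨fun k => t ⟨i, k⟩, ⟨fun k => ht.1 _, fun k => ht.2 _⟩, ?_⟩
      rw [← key, ← hx]
      rfl
    · intro h
      choose t ht hx using h
      refine ⟨fun p => t p.1 p.2, ⟨fun p => (ht p.1).1 _, fun p => (ht p.1).2 _⟩, ?_⟩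
      ext i
      rw [key, ← hx]
      rfl
  rw [Measure.map_apply e.continuous.measurable
    b.toBasis.parallelepiped.isCompact.isClosed.measurableSet, hset, volume_pi, Measure.pi_pi]
  exact Finset.prod_eq_one fun _ _ => OrthonormalBasis.volume_parallelepiped _

theorem CSpace.volume_sum_norm_lt_one (n : ℕ) :
    volume {x : CSpace n | ∑ i, ‖x i‖ < 1} =
      ENNReal.ofReal ((2 * Real.pi) ^ n / (2 * n).factorial) := by
  have hm : MeasurableSet {x : CSpace n | ∑ i, ‖x i‖ < 1} :=
    (isOpen_lt (by fun_prop) (by fun_prop)).measurableSet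
  rw [← (EuclideanSpace.volume_preserving_toLp_complex (Fin n)).measure_preimage
    hm.nullMeasurableSet]
  have := Complex.volume_sum_rpow_lt_one (Fin n) (le_refl (1 : ℝ))
  simp only [Real.rpow_one] at this
  rw [Set.preimage_ofPred_eq, this]
  congr 2
  · norm_num [Real.Gamma_ofNat_eq_factorial, mul_comm]
  · have := Real.Gamma_nat_eq_factorial (2 * n)
    rw [← this]
    simp

theorem CSpace.volume_polydisc (n : ℕ) :
    volume {x : CSpace n | ∀ i, ‖x i‖ < 1} = ENNReal.ofReal (Real.pi ^ n) := by
  have hm : MeasurableSet {x : CSpace n | ∀ i, ‖x i‖ < 1} := by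
    rw [Set.ofPred_forall]
    exact MeasurableSet.iInter fun i =>
      (isOpen_lt (by fun_prop) (by fun_prop)).measurableSet
  rw [← (EuclideanSpace.volume_preserving_toLp_complex (Fin n)).measure_preimage
    hm.nullMeasurableSet]
  have : (WithLp.toLp 2 : (Fin n → ℂ) → CSpace n) ⁻¹' {x : CSpace n | ∀ i, ‖x i‖ < 1} =
      Set.pi Set.univ fun _ => Metric.ball 0 1 := by
    ext x; simp
  rw [this, volume_pi, Measure.pi_pi]
  simp [Complex.volume_ball, ENNReal.ofReal_pow Real.pi_nonneg]
  congr 1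
  rw [← ENNReal.ofReal_coe_nnreal]
  rfl

/-! ### Inner and outer linear models of the domain -/

/-- A point of a convex domain without complex lines lies at the centre of a disc `z + t u`,
`|t| < 1`, in a prescribed complex direction, whose boundary point `z + u` admits a complex
supporting functional. -/
theorem exists_disc_and_support {n : ℕ} {D : Set (CSpace n)} (hopen : IsOpen D)
    (hconv : Convex ℝ D) (hnd : NonDegenerate D) {z : CSpace n} (hz : z ∈ D)
    {v : CSpace n} (hv : v ≠ 0) :
    ∃ (s : ℂ) (l : CSpace n →L[ℂ] ℂ), (∀ t : ℂ, ‖t‖ < 1 → z + t • s • v ∈ D) ∧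
      (∀ x ∈ D, (l (x - z)).re < 1) ∧ l (s • v) = 1 := by
  have hcl : IsClosed {t : ℂ | z + t • v ∉ D} :=
    (hopen.preimage (f := fun t : ℂ => z + t • v) (by fun_prop)).isClosed_compl
  have hne : {t : ℂ | z + t • v ∉ D}.Nonempty := by
    by_contra h
    rw [Set.not_nonempty_iff_eq_empty, Set.eq_empty_iff_forall_notMem] at h
    exact hnd ⟨z, v, hv, fun t => not_not.1 (h t)⟩
  -- The parameter `s` is an exit point of the line nearest to `0`, so the disc of radius `‖s‖`
  -- stays in `D`.
  obtain ⟨s, hs, hdist⟩ := hcl.exists_infDist_eq_dist hne 0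
  have hs0 : s ≠ 0 := by
    rintro rfl
    exact hs (by simpa using hz)
  have hdisc : ∀ t : ℂ, ‖t‖ < 1 → z + t • s • v ∈ D := by
    intro t ht
    by_contra hcon
    have h1 : Metric.infDist 0 {t : ℂ | z + t • v ∉ D} ≤ dist 0 (t * s) :=
      Metric.infDist_le_dist_of_mem (by simpa [mul_smul] using hcon)
    rw [hdist, dist_zero_left, dist_zero_left, norm_mul] at h1
    have : 0 < ‖s‖ := norm_pos_iff.2 hs0
    nlinarith
  obtain ⟨f, hf⟩ := RCLike.geometric_hahn_banach_open_point (𝕜 := ℂ) hconv hopen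
    (x := z + s • v) hs
  simp only [RCLike.re_eq_complex_re, map_add] at hf
  set a : ℂ := f (s • v) with ha
  have ha0 : 0 < a.re := by
    have := hf z hz
    linarith
  have hre : ∀ t : ℂ, ‖t‖ < 1 → (t * a).re < a.re := by
    intro t ht
    have := hf _ (hdisc t ht)
    rw [map_add, map_smul, Complex.add_re, smul_eq_mul] at this
    linarith
  have hane : a ≠ 0 := fun h => by simp [h] at ha0
  -- Testing with `t = r * conj a / ‖a‖²`, `0 < r < ‖a‖`, makes `t * a = r`. Hence `a` is a positive
  -- real, and dividing `f` by it preserves the real-part inequality.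
  have haabs : ‖a‖ ≤ a.re := by
    have hn : 0 < ‖a‖ := norm_pos_iff.2 hane
    refine le_of_forall_lt_imp_le_of_dense fun r hr => ?_
    by_cases hr0 : r ≤ 0
    · exact hr0.trans ha0.le
    push Not at hr0
    have h1 : ‖((r / ‖a‖ ^ 2 : ℝ) : ℂ) * conj a‖ < 1 := by
      rw [norm_mul, Complex.norm_real, Complex.norm_conj, Real.norm_of_nonneg (by positivity)]
      rw [div_mul_eq_mul_div, div_lt_one (by positivity)]
      nlinarith
    have h2 := hre _ h1
    rw [mul_assoc, ← Complex.normSq_eq_conj_mul_self, Complex.normSq_eq_norm_sq,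
      ← Complex.ofReal_mul, Complex.ofReal_re, div_mul_cancel₀ _ (by positivity)] at h2
    exact h2.le
  have hareal : a = (a.re : ℂ) := by
    have h : a.re = ‖a‖ := le_antisymm (Complex.re_le_norm a) haabs
    rw [h, eq_comm]
    exact Complex.re_eq_norm.1 h |> fun h0 => (Complex.eq_coe_norm_of_nonneg h0).symm
  refine ⟨s, a⁻¹ • f, hdisc, fun x hx => ?_, ?_⟩
  · have := hf x hx
    rw [hareal]
    rw [← Complex.ofReal_inv, _root_.smul_apply, smul_eq_mul, Complex.re_ofReal_mul,
      map_sub, Complex.sub_re, inv_mul_lt_one₀ ha0]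
    linarith
  · simp only [_root_.smul_apply, smul_eq_mul]
    exact inv_mul_cancel₀ hane

/-- Each new direction is chosen in the common kernel of the earlier functionals, which is nonzero
while there are fewer than `n` of them. -/
theorem exists_triangular_system {n : ℕ} {D : Set (CSpace n)} (hopen : IsOpen D)
    (hconv : Convex ℝ D) (hnd : NonDegenerate D) {z : CSpace n} (hz : z ∈ D) :
    ∀ m ≤ n, ∃ (u : Fin m → CSpace n) (l : Fin m → CSpace n →L[ℂ] ℂ),
      (∀ j, ∀ t : ℂ, ‖t‖ < 1 → z + t • u j ∈ D) ∧ (∀ j, ∀ x ∈ D, (l j (x - z)).re < 1) ∧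
      (∀ j, l j (u j) = 1) ∧ ∀ j k, j < k → l j (u k) = 0 := by
  intro m
  induction m with
  | zero => exact fun _ => ⟨Fin.elim0, Fin.elim0, fun j => j.elim0, fun j => j.elim0,
      fun j => j.elim0, fun j => j.elim0⟩
  | succ m ih =>
    intro hm
    obtain ⟨u, l, h1, h2, h3, h4⟩ := ih (by omega)
    have hker : (LinearMap.pi fun j => (l j : CSpace n →ₗ[ℂ] ℂ)).ker ≠ ⊥ :=
      LinearMap.ker_ne_bot_of_finrank_lt (by simpa using hm)
    obtain ⟨v, hvker, hv⟩ := Submodule.exists_mem_ne_zero_of_ne_bot hker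
    have hv0 : ∀ j, l j v = 0 := fun j => congrFun (LinearMap.mem_ker.1 hvker) j
    obtain ⟨s, f, hd, hf, hfs⟩ := exists_disc_and_support hopen hconv hnd hz hv
    refine ⟨Fin.snoc u (s • v), Fin.snoc l f, fun j => ?_, fun j => ?_, fun j => ?_, fun j => ?_⟩
    · refine Fin.lastCases ?_ (fun i => ?_) j
      · simpa using hd
      · simpa using h1 i
    · refine Fin.lastCases ?_ (fun i => ?_) j
      · simpa using hf
      · simpa using h2 i
    · refine Fin.lastCases ?_ (fun i => ?_) j
      · simpa using hfs
      · simpa using h3 i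
    · intro k
      refine Fin.lastCases ?_ (fun i => ?_) j
      · intro h
        exact absurd h (not_lt.2 (Fin.le_last k))
      · refine Fin.lastCases (fun _ => ?_) (fun k hk => ?_) k
        · simp [hv0]
        · simpa using h4 i k (by simpa using hk)

theorem exists_inner_and_outer_linear_maps {n : ℕ} {D : Set (CSpace n)} (hopen : IsOpen D)
    (hconv : Convex ℝ D) (hnd : NonDegenerate D) {z : CSpace n} (hz : z ∈ D) :
    ∃ U Λ : CSpace n →L[ℂ] CSpace n, (∀ x : CSpace n, ∑ i, ‖x i‖ < 1 → z + U x ∈ D) ∧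
      (∀ x ∈ D, ∀ j, (Λ (x - z) j).re < 1) ∧ Λ.det * U.det = 1 := by
  classical
  obtain ⟨u, l, h1, h2, h3, h4⟩ := exists_triangular_system hopen hconv hnd hz n le_rfl
  let U : CSpace n →L[ℂ] CSpace n := ∑ j, (EuclideanSpace.proj j : CSpace n →L[ℂ] ℂ).smulRight (u j)
  let Λ : CSpace n →L[ℂ] CSpace n :=
    ((PiLp.continuousLinearEquiv 2 ℂ (fun _ : Fin n => ℂ)).symm : (Fin n → ℂ) →L[ℂ] CSpace n) ∘L
      ContinuousLinearMap.pi l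
  have hU : ∀ x, U x = ∑ j, x j • u j := fun x => by
    simp [U, _root_.sum_apply]
  have hΛ : ∀ x j, Λ x j = l j x := fun x j => rfl
  refine ⟨U, Λ, fun x hx => ?_, fun x hx j => h2 j x hx, ?_⟩
  · rcases Nat.eq_zero_or_pos n with rfl | hn
    · simpa [hU] using hz
    have hn' : (0 : ℝ) < n := by exact_mod_cast hn
    set s := ∑ i, ‖x i‖ with hs
    -- The slack `1 - s` is shared equally, so the weights sum to `1` and strictly exceed `‖x i‖`.
    -- Then `z + U x` is a convex combination of points of the open discs.
    let w : Fin n → ℝ := fun i => ‖x i‖ + (1 - s) / n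
    have hw : ∀ i, ‖x i‖ < w i := fun i => by
      have : 0 < (1 - s) / n := div_pos (by linarith) hn'
      simp only [w]; linarith
    have hw0 : ∀ i, 0 < w i := fun i => (norm_nonneg _).trans_lt (hw i)
    have hsum : ∑ i, w i = 1 := by
      simp only [w, Finset.sum_add_distrib, ← hs, Finset.sum_const, Finset.card_univ,
        Fintype.card_fin, nsmul_eq_mul]
      field_simp
      ring
    have hp : ∀ i, z + (x i / w i) • u i ∈ D := fun i => h1 i _ (by
      rw [norm_div, Complex.norm_real, Real.norm_of_nonneg (hw0 i).le, div_lt_one (hw0 i)]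
      exact hw i)
    have := hconv.sum_mem (t := Finset.univ) (fun i _ => (hw0 i).le) hsum (fun i _ => hp i)
    convert this using 1
    simp only [smul_add, Finset.sum_add_distrib, ← Finset.sum_smul, hsum, one_smul, hU]
    congr 1
    refine Finset.sum_congr rfl fun i _ => ?_
    rw [← Complex.coe_smul, smul_smul, mul_div_cancel₀]
    exact_mod_cast (hw0 i).ne'
  · rw [ContinuousLinearMap.det, ContinuousLinearMap.det, ← LinearMap.det_comp,
      ← LinearMap.det_toMatrix (EuclideanSpace.basisFun (Fin n) ℂ).toBasis,
      Matrix.det_of_isLowerTriangular]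
    · refine Finset.prod_eq_one fun i _ => ?_
      simp [LinearMap.toMatrix_apply, hU, hΛ, h3]
    · intro i j hij
      simpa [LinearMap.toMatrix_apply, hU, hΛ] using h4 i j hij

/-! ### Determinants and the comparison of the two volume elements -/

/-- Power trick: the crude bound `n!` holds for every contraction, hence for all `A ^ k`, which
keeps the powers of `‖det A‖` bounded. -/
theorem ContinuousLinearMap.norm_det_le_one {n : ℕ} (A : CSpace n →L[ℂ] CSpace n)
    (hA : ‖A‖ ≤ 1) : ‖A.det‖ ≤ 1 := by
  classical
  have hb (B : CSpace n →L[ℂ] CSpace n) (hB : ‖B‖ ≤ 1) : ‖B.det‖ ≤ n.factorial := by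
    rw [ContinuousLinearMap.det,
      ← LinearMap.det_toMatrix (EuclideanSpace.basisFun (Fin n) ℂ).toBasis]
    have := Matrix.det_le (abv := NormedField.toAbsoluteValue ℂ) (x := 1)
      (A := LinearMap.toMatrix (EuclideanSpace.basisFun (Fin n) ℂ).toBasis
        (EuclideanSpace.basisFun (Fin n) ℂ).toBasis (B : CSpace n →ₗ[ℂ] CSpace n)) ?_
    · rw [Fintype.card_fin, one_pow, nsmul_one] at this
      exact this
    · intro i j
      have h1 : ‖B (EuclideanSpace.single j 1)‖ ≤ 1 * 1 := by
        refine B.le_of_opNorm_le_of_le hB ?_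
        simp
      have h2 := (PiLp.norm_apply_le (B (EuclideanSpace.single j 1)) i).trans h1
      rw [LinearMap.toMatrix_apply]
      change ‖(_ : ℂ)‖ ≤ _
      simpa using h2
  by_contra! hlt
  obtain ⟨k, hk⟩ := pow_unbounded_of_one_lt (n.factorial : ℝ) hlt
  have h1 : ‖A ^ k‖ ≤ 1 := by
    rcases Nat.eq_zero_or_pos k with rfl | hk0
    · rw [pow_zero]; exact ContinuousLinearMap.norm_id_le
    · exact (norm_pow_le' A hk0).trans (pow_le_one₀ (norm_nonneg _) hA)
  have h2 : (A ^ k).det = A.det ^ k := by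
    rw [ContinuousLinearMap.det, ContinuousLinearMap.toLinearMap_pow, map_pow]
  have := hb _ h1
  rw [h2, norm_pow] at this
  linarith

theorem ContinuousLinearMap.abs_det_restrictScalars {n : ℕ} (A : CSpace n →L[ℂ] CSpace n) :
    |(A.restrictScalars ℝ).det| = ‖A.det‖ ^ 2 := by
  have : (A.restrictScalars ℝ).det = Complex.normSq A.det := by
    rw [← Algebra.norm_complex_apply, ContinuousLinearMap.det, ContinuousLinearMap.det,
      ← LinearMap.det_restrictScalars]
    rfl
  rw [this, Complex.normSq_eq_norm_sq, abs_of_nonneg (by positivity)]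

/-- For competitors `φ` and `ψ`, the composite `φ ∘ ψ` maps the ball to itself fixing `0`; by
Schwarz its derivative there is a contraction. -/
theorem caratheodoryVol_le_kobayashiVol {n : ℕ} {D : Set (CSpace n)} (hopen : IsOpen D)
    {z : CSpace n} (hz : z ∈ D) : caratheodoryVol D z ≤ kobayashiVol D z := by
  refine iSup₂_le fun φ hφ => le_iInf₂ fun ψ hψ => ?_
  obtain ⟨⟨hφd, hφm⟩, hφ0⟩ := hφ
  obtain ⟨⟨hψd, hψm⟩, hψ0⟩ := hψ
  have hmaps : Set.MapsTo (φ ∘ ψ) (Metric.ball 0 1) (Metric.closedBall ((φ ∘ ψ) 0) 1) := by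
    rw [Function.comp_apply, hψ0, hφ0]
    exact (hφm.comp hψm).mono_right Metric.ball_subset_closedBall
  have hle := Complex.norm_fderiv_le_one_of_mapsTo_ball (hφd.comp hψd hψm) hmaps one_pos
  have hψat : DifferentiableAt ℂ ψ 0 :=
    hψd.differentiableAt (Metric.ball_mem_nhds _ one_pos)
  have hφat : DifferentiableAt ℂ φ (ψ 0) := by
    rw [hψ0]; exact hφd.differentiableAt (hopen.mem_nhds hz)
  rw [fderiv_comp _ hφat hψat, hψ0] at hle
  have hdet := ContinuousLinearMap.norm_det_le_one _ hle
  have hmul : ((fderiv ℂ φ z).comp (fderiv ℂ ψ 0)).det =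
      (fderiv ℂ φ z).det * (fderiv ℂ ψ 0).det := by
    simp only [ContinuousLinearMap.det]
    exact LinearMap.det_comp _ _
  rw [hmul, norm_mul] at hdet
  rw [ENNReal.le_inv_iff_mul_le, ← mul_pow]
  refine pow_le_one₀ zero_le ?_
  rw [← ofReal_norm, ← ofReal_norm, ← ENNReal.ofReal_mul (norm_nonneg _)]
  exact ENNReal.ofReal_le_one.2 hdet

/-! ### Mean value property and pointwise `L²` bounds -/

theorem norm_integral_mul_conj_sq_le {α : Type*} [MeasurableSpace α] {μ : Measure α}
    {f g : α → ℂ} (hf : MemLp f 2 μ) (hg : MemLp g 2 μ) :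
    ‖∫ x, f x * conj (g x) ∂μ‖ ^ 2 ≤ (∫ x, ‖f x‖ ^ 2 ∂μ) * ∫ x, ‖g x‖ ^ 2 ∂μ := by
  have h1 : ‖∫ x, f x * conj (g x) ∂μ‖ ≤ ∫ x, ‖f x‖ * ‖g x‖ ∂μ := by
    refine (norm_integral_le_integral_norm _).trans_eq ?_
    simp
  have h2 := integral_mul_norm_le_Lp_mul_Lq (μ := μ) (f := f) (g := g) Real.HolderConjugate.two_two
    (by simpa using hf) (by simpa using hg)
  simp only [Real.rpow_ofNat, ← Real.sqrt_eq_rpow] at h2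
  have hf0 : 0 ≤ ∫ x, ‖f x‖ ^ 2 ∂μ := integral_nonneg fun _ => by positivity
  have hg0 : 0 ≤ ∫ x, ‖g x‖ ^ 2 ∂μ := integral_nonneg fun _ => by positivity
  calc _ ≤ (√(∫ x, ‖f x‖ ^ 2 ∂μ) * √(∫ x, ‖g x‖ ^ 2 ∂μ)) ^ 2 := by
        gcongr
        exact h1.trans h2
    _ = _ := by rw [mul_pow, Real.sq_sqrt hf0, Real.sq_sqrt hg0]

/-- The mean value property of holomorphic functions over balanced open sets. -/
theorem setIntegral_eq_of_balanced {n : ℕ} {Q : Set (CSpace n)} (hQ : IsOpen Q)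
    (hbal : Balanced ℂ Q) {g : CSpace n → ℂ} (hg : DifferentiableOn ℂ g Q)
    (hint : IntegrableOn g Q) : ∫ x in Q, g x = volume.real Q * g 0 := by
  have hrot : ∀ θ : ℝ, MeasurePreserving (fun x : CSpace n => circleMap 0 1 θ • x) := fun θ => by
    have hc : ‖circleMap 0 1 θ‖ = 1 := by simp
    let e : CSpace n ≃ₗᵢ[ℝ] CSpace n :=
      { LinearEquiv.smulOfUnit (R := ℂ) (M := CSpace n) ⟨circleMap 0 1 θ, (circleMap 0 1 θ)⁻¹,
          mul_inv_cancel₀ (by simp), inv_mul_cancel₀ (by simp)⟩ |>.restrictScalars ℝ with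
        norm_map' := fun x => by
          change ‖circleMap 0 1 θ • x‖ = ‖x‖
          rw [norm_smul, hc, one_mul] }
    exact e.measurePreserving
  have hemb : ∀ θ : ℝ, MeasurableEmbedding (fun x : CSpace n => circleMap 0 1 θ • x) := fun θ =>
    (Homeomorph.smulOfNeZero (circleMap 0 1 θ) (by simp)).measurableEmbedding
  have hmem : ∀ (θ : ℝ) (x : CSpace n), circleMap 0 1 θ • x ∈ Q ↔ x ∈ Q := fun θ x => by
    have : ‖circleMap 0 1 θ‖ = ‖(1 : ℂ)‖ := by simp
    simpa using hbal.smul_mem_iff this (x := x)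
  have hpre : ∀ θ : ℝ, (fun x : CSpace n => circleMap 0 1 θ • x) ⁻¹' Q = Q := fun θ => by
    ext x
    exact hmem θ x
  have hI (h : CSpace n → ℂ) (θ : ℝ) : ∫ x in Q, h (circleMap 0 1 θ • x) = ∫ x in Q, h x := by
    have := (hrot θ).setIntegral_preimage_emb (hemb θ) h Q
    rwa [hpre] at this
  have hIn (θ : ℝ) : ∫ x in Q, ‖g (circleMap 0 1 θ • x)‖ = ∫ x in Q, ‖g x‖ := by
    have := (hrot θ).setIntegral_preimage_emb (hemb θ) (fun x => ‖g x‖) Q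
    rwa [hpre] at this
  have hInt (θ : ℝ) : IntegrableOn (fun x => g (circleMap 0 1 θ • x)) Q := by
    have := (hrot θ).integrableOn_comp_preimage (hemb θ) (f := g) (s := Q)
    rw [hpre] at this
    exact this.2 hint
  have hcont : ContinuousOn (fun p : ℝ × CSpace n => g (circleMap 0 1 p.1 • p.2))
      (Set.univ ×ˢ Q) := by
    refine hg.continuousOn.comp (by fun_prop) ?_
    rintro ⟨θ, x⟩ ⟨-, hx⟩
    exact (hmem θ x).2 hx
  have hprod : Integrable (fun p : ℝ × CSpace n => g (circleMap 0 1 p.1 • p.2))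
      ((volume.restrict (Set.uIoc 0 (2 * Real.pi))).prod (volume.restrict Q)) := by
    have hmeas : AEStronglyMeasurable (fun p : ℝ × CSpace n => g (circleMap 0 1 p.1 • p.2))
        ((volume.restrict (Set.uIoc 0 (2 * Real.pi))).prod (volume.restrict Q)) := by
      rw [Measure.prod_restrict]
      exact (hcont.mono (Set.prod_mono_left (Set.subset_univ _))).aestronglyMeasurable
        (measurableSet_uIoc.prod hQ.measurableSet)
    rw [integrable_prod_iff hmeas]
    refine ⟨Filter.Eventually.of_forall hInt, ?_⟩
    simp only [hIn]
    rw [Set.uIoc_of_le (by positivity)]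
    exact integrable_const _
  -- Integrating `g (e^{iθ} x)` over `x` first gives `∫ g` for every `θ`, by rotation invariance;
  -- integrating over `θ` first gives `2π g 0`, by the mean value property on a disc.
  have hswap := intervalIntegral_integral_swap (a := 0) (b := 2 * Real.pi)
    (f := fun θ x => g (circleMap 0 1 θ • x)) hprod
  simp only [hI, intervalIntegral.integral_const, sub_zero] at hswap
  have hmean : ∀ x ∈ Q, ∫ θ in (0 : ℝ)..(2 * Real.pi), g (circleMap 0 1 θ • x) =
      (2 * Real.pi) • g 0 := by
    intro x hx
    have hd : DiffContOnCl ℂ (fun t : ℂ => g (t • x)) (Metric.ball 0 |1|) := by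
      refine DifferentiableOn.diffContOnCl ?_
      refine hg.comp (by fun_prop) fun t ht => ?_
      rw [abs_one, closure_ball _ one_ne_zero, mem_closedBall_zero_iff] at ht
      exact hbal.smul_mem ht hx
    have := hd.circleAverage
    rw [Real.circleAverage, zero_smul, inv_smul_eq_iff₀ (by positivity)] at this
    exact this
  rw [setIntegral_congr_fun hQ.measurableSet hmean, setIntegral_const] at hswap
  have hpi : (2 * Real.pi) ≠ 0 := by positivity
  have := congrArg (fun y => (2 * Real.pi)⁻¹ • y) hswap
  simp only [inv_smul_smul₀ hpi] at this
  rw [this, smul_comm, inv_smul_smul₀ hpi, Complex.real_smul]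

/-- Mean value property for the translate of `f`, followed by Cauchy–Schwarz against the constant
`1`; one factor of the volume cancels. -/
theorem norm_sq_mul_volume_le_of_balanced {n : ℕ} {Q : Set (CSpace n)} (hQ : IsOpen Q)
    (hbal : Balanced ℂ Q) (hfin : volume Q ≠ ∞) {D : Set (CSpace n)} {f : CSpace n → ℂ}
    (hf : f ∈ bergmanSpace D) {z : CSpace n} (hzQ : ∀ x ∈ Q, z + x ∈ D) :
    ‖f z‖ ^ 2 * volume.real Q ≤ ∫ x in D, ‖f x‖ ^ 2 := by
  have hsub : (fun x => z + x) '' Q ⊆ D := by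
    rintro _ ⟨x, hx, rfl⟩
    exact hzQ x hx
  have hmp : MeasurePreserving (fun x : CSpace n => z + x) := measurePreserving_add_left volume z
  have hemb : MeasurableEmbedding (fun x : CSpace n => z + x) := measurableEmbedding_addLeft z
  have hmpQ : MeasurePreserving (fun x : CSpace n => z + x) (volume.restrict Q)
      (volume.restrict ((fun x => z + x) '' Q)) := hmp.restrict_image_emb hemb Q
  have hL : MemLp (fun x => f (z + x)) 2 (volume.restrict Q) :=
    (hf.2.mono_measure (Measure.restrict_mono hsub le_rfl)).comp_measurePreserving hmpQ
  have hfm : IsFiniteMeasure (volume.restrict Q) :=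
    ⟨by rw [Measure.restrict_apply_univ]; exact hfin.lt_top⟩
  have hmv := setIntegral_eq_of_balanced hQ hbal (g := fun x => f (z + x))
    (hf.1.comp (by fun_prop) hzQ) (hL.integrable (by norm_num))
  have hcs := norm_integral_mul_conj_sq_le hL (memLp_const (1 : ℂ))
  simp only [map_one, mul_one, hmv, add_zero, norm_mul, Complex.norm_real, norm_one, one_pow,
    integral_const, smul_eq_mul, Real.norm_of_nonneg measureReal_nonneg,
    measureReal_restrict_apply_univ, mul_pow] at hcs
  have hle : ∫ x in Q, ‖f (z + x)‖ ^ 2 ≤ ∫ x in D, ‖f x‖ ^ 2 := by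
    rw [hmp.setIntegral_image_emb hemb (fun x => ‖f x‖ ^ 2) Q |>.symm]
    exact setIntegral_mono_set ((memLp_two_iff_integrable_sq_norm hf.2.1).1 hf.2)
      (Filter.Eventually.of_forall fun _ => by positivity) (Filter.Eventually.of_forall hsub)
  refine le_trans ?_ hle
  rcases (measureReal_nonneg (μ := volume) (s := Q)).eq_or_lt with h0 | h0
  · rw [← h0, mul_zero]
    exact integral_nonneg fun _ => by positivity
  · nlinarith

/-! ### Completeness of the Bergman space and existence of the kernel -/

theorem differentiableAt_of_uniformCauchySeqOn {E : Type*} [NormedAddCommGroup E]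
    [NormedSpace ℂ E] {f : ℕ → E → ℂ} {g : E → ℂ} {w : E} {r : ℝ} (hr : 0 < r)
    (hf : ∀ k, DifferentiableOn ℂ (f k) (Metric.ball w r))
    (hc : UniformCauchySeqOn f Filter.atTop (Metric.ball w r))
    (hg : ∀ x ∈ Metric.ball w r, Filter.Tendsto (fun k => f k x) Filter.atTop (nhds (g x))) :
    DifferentiableAt ℂ g w := by
  have hr2 : 0 < r / 2 := by positivity
  have hsub : ∀ y ∈ Metric.ball w (r / 2), Metric.ball y (r / 2) ⊆ Metric.ball w r := by
    intro y hy
    refine Metric.ball_subset_ball' ?_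
    rw [Metric.mem_ball] at hy
    linarith
  have hfd : ∀ k, ∀ y ∈ Metric.ball w (r / 2), HasFDerivAt (f k) (fderiv ℂ (f k) y) y :=
    fun k y hy => ((hf k).differentiableAt
      (Filter.mem_of_superset (Metric.ball_mem_nhds y hr2) (hsub y hy))).hasFDerivAt
  have hc' : UniformCauchySeqOn (fun k => fderiv ℂ (f k)) Filter.atTop
      (Metric.ball w (r / 2)) := by
    rw [Metric.uniformCauchySeqOn_iff] at hc ⊢
    intro ε hε
    -- Differences then oscillate by at most `ε r / 4` on balls of radius `r / 2`, so the Schwarz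
    -- estimate bounds the derivative differences by `ε / 2`.
    obtain ⟨N, hN⟩ := hc (ε * r / 8) (by positivity)
    refine ⟨N, fun k hk m hm y hy => ?_⟩
    have hmaps : Set.MapsTo (f k - f m) (Metric.ball y (r / 2))
        (Metric.closedBall ((f k - f m) y) (ε * r / 4)) := by
      intro x hx
      have h1 := hN k hk m hm x (hsub y hy hx)
      have h2 := hN k hk m hm y (hsub y hy (Metric.mem_ball_self hr2))
      rw [dist_eq_norm] at h1 h2
      rw [Metric.mem_closedBall, dist_eq_norm, Pi.sub_apply, Pi.sub_apply]
      refine (norm_sub_le _ _).trans ?_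
      linarith
    have hle := Complex.norm_fderiv_le_div_of_mapsTo_ball
      (((hf k).sub (hf m)).mono (hsub y hy)) hmaps hr2
    rw [dist_eq_norm, ← fderiv_sub (hfd k y hy).differentiableAt (hfd m y hy).differentiableAt]
    refine hle.trans_lt ?_
    rw [div_lt_iff₀ hr2]
    nlinarith [mul_pos hε hr]
  have hlim : ∀ y ∈ Metric.ball w (r / 2), ∃ A, Filter.Tendsto (fun k => fderiv ℂ (f k) y)
      Filter.atTop (nhds A) := fun y hy => cauchySeq_tendsto_of_complete (hc'.cauchySeq hy)
  choose! g' hg' using hlim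
  exact (hasFDerivAt_of_tendstoUniformlyOn Metric.isOpen_ball
    (hc'.tendstoUniformlyOn_of_tendsto hg') hfd
    (fun x hx => hg x (Metric.ball_subset_ball (by linarith) hx))
    (Metric.mem_ball_self hr2)).differentiableAt

theorem norm_apply_le_of_ball_subset {n : ℕ} {D : Set (CSpace n)} {r : ℝ} {z : CSpace n}
    (hr : 0 < r) (hball : Metric.ball z r ⊆ D) {f : CSpace n → ℂ} (hf : DifferentiableOn ℂ f D)
    (F : Lp ℂ 2 (volume.restrict D)) (hF : F =ᵐ[volume.restrict D] f) :
    ‖f z‖ ≤ (√(volume.real (Metric.ball (0 : CSpace n) r)))⁻¹ * ‖F‖ := by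
  have hfL : MemLp f 2 (volume.restrict D) := (Lp.memLp F).ae_eq hF
  have hvol : 0 < volume.real (Metric.ball (0 : CSpace n) r) :=
    ENNReal.toReal_pos (Metric.measure_ball_pos _ _ hr).ne' measure_ball_lt_top.ne
  have h := norm_sq_mul_volume_le_of_balanced Metric.isOpen_ball
    (balanced_ball_zero (𝕜 := ℂ) (E := CSpace n) (r := r)) measure_ball_lt_top.ne ⟨hf, hfL⟩
    (z := z) (fun x hx => hball (by simpa using hx))
  have hnorm : ‖F‖ ^ 2 = ∫ x in D, ‖f x‖ ^ 2 := by
    have h2 : inner ℂ F F = (‖F‖ : ℂ) ^ 2 := inner_self_eq_norm_sq_to_K F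
    rw [L2.inner_def] at h2
    have h3 : (fun a => inner ℂ (F a) (F a)) =ᵐ[volume.restrict D]
        fun a => ((‖f a‖ ^ 2 : ℝ) : ℂ) := by
      filter_upwards [hF] with a ha
      rw [ha, inner_self_eq_norm_sq_to_K]
      simp
    rw [integral_congr_ae h3, integral_complex_ofReal] at h2
    exact_mod_cast h2.symm
  rw [← hnorm] at h
  rw [inv_mul_eq_div, le_div_iff₀ (Real.sqrt_pos.2 hvol)]
  refine (pow_le_pow_iff_left₀ (by positivity) (norm_nonneg _) two_ne_zero).1 ?_
  rwa [mul_pow, Real.sq_sqrt hvol.le]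

/-- The Bergman space as a subspace of `L²`. -/
noncomputable def bergmanSubmodule {n : ℕ} (D : Set (CSpace n)) :
    Submodule ℂ (Lp ℂ 2 (volume.restrict D)) where
  carrier := {F | ∃ f : CSpace n → ℂ, DifferentiableOn ℂ f D ∧ F =ᵐ[volume.restrict D] f}
  add_mem' := by
    rintro F G ⟨f, hf, hFf⟩ ⟨g, hg, hGg⟩
    exact ⟨f + g, hf.add hg, (Lp.coeFn_add F G).trans (hFf.add hGg)⟩
  zero_mem' := ⟨0, differentiableOn_const _, Lp.coeFn_zero _ _ _⟩
  smul_mem' := by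
    rintro c F ⟨f, hf, hFf⟩
    exact ⟨c • f, hf.const_smul c, (Lp.coeFn_smul c F).trans (hFf.const_smul c)⟩

/-- Evaluation is bounded by the `L²` norm with a constant depending only on the radius of a ball
inside `D`, so `L²` convergence forces locally uniform convergence; an a.e. convergent subsequence
identifies the two limits. -/
theorem isClosed_bergmanSubmodule {n : ℕ} {D : Set (CSpace n)} (hD : IsOpen D) :
    IsClosed (bergmanSubmodule D : Set (Lp ℂ 2 (volume.restrict D))) := by
  refine isClosed_of_closure_subset fun F hF => ?_
  obtain ⟨G, hG, hlim⟩ := mem_closure_iff_seq_limit.1 hF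
  choose f hf hGf using hG
  have hcauchy : ∀ (w : CSpace n) (r : ℝ), 0 < r → Metric.ball w (2 * r) ⊆ D →
      UniformCauchySeqOn f Filter.atTop (Metric.ball w r) := by
    intro w r hr hw
    set C := (√(volume.real (Metric.ball (0 : CSpace n) r)))⁻¹ with hC
    have hC0 : 0 ≤ C := by positivity
    rw [Metric.uniformCauchySeqOn_iff]
    intro ε hε
    obtain ⟨N, hN⟩ := Metric.cauchySeq_iff.1 hlim.cauchySeq (ε / (C + 1)) (by positivity)
    refine ⟨N, fun k hk m hm x hx => ?_⟩
    have hb : Metric.ball x r ⊆ D := by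
      refine (Metric.ball_subset_ball' ?_).trans hw
      rw [Metric.mem_ball] at hx
      linarith
    have h1 := norm_apply_le_of_ball_subset hr hb ((hf k).sub (hf m)) (G k - G m)
      ((Lp.coeFn_sub _ _).trans ((hGf k).sub (hGf m)))
    have h2 := hN k hk m hm
    rw [dist_eq_norm, lt_div_iff₀ (by positivity)] at h2
    rw [dist_eq_norm]
    calc _ ≤ C * ‖G k - G m‖ := h1
      _ ≤ ‖G k - G m‖ * (C + 1) := by nlinarith [norm_nonneg (G k - G m)]
      _ < ε := h2
  have hball : ∀ w ∈ D, ∃ r, 0 < r ∧ Metric.ball w (2 * r) ⊆ D := by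
    intro w hw
    obtain ⟨r, hr, hsub⟩ := Metric.isOpen_iff.1 hD w hw
    exact ⟨r / 2, by positivity, by rwa [mul_div_cancel₀ _ two_ne_zero]⟩
  have hptw : ∀ w ∈ D, ∃ a, Filter.Tendsto (fun k => f k w) Filter.atTop (nhds a) := by
    intro w hw
    obtain ⟨r, hr, hsub⟩ := hball w hw
    exact cauchySeq_tendsto_of_complete
      ((hcauchy w r hr hsub).cauchySeq (Metric.mem_ball_self hr))
  choose! g hg using hptw
  refine ⟨g, fun w hw => ?_, ?_⟩
  · obtain ⟨r, hr, hsub⟩ := hball w hw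
    have hsub' : Metric.ball w r ⊆ D := (Metric.ball_subset_ball (by linarith)).trans hsub
    exact (differentiableAt_of_uniformCauchySeqOn hr (fun k => (hf k).mono hsub')
      (hcauchy w r hr hsub) fun x hx => hg x (hsub' hx)).differentiableWithinAt
  · obtain ⟨ns, hns, hae⟩ := (tendstoInMeasure_of_tendsto_Lp hlim).exists_seq_tendsto_ae
    have hall : ∀ᵐ x ∂(volume.restrict D), ∀ k, G k x = f k x := ae_all_iff.2 hGf
    filter_upwards [hae, hall, ae_restrict_mem hD.measurableSet] with x hx hxf hxD
    refine tendsto_nhds_unique hx ?_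
    simp only [hxf]
    exact (hg x hxD).comp hns.tendsto_atTop

/-- Riesz representation of evaluation at `w` on the complete space `bergmanSubmodule D`. -/
theorem exists_isBergmanKernel {n : ℕ} {D : Set (CSpace n)} (hD : IsOpen D) :
    ∃ K, IsBergmanKernel D K := by
  have hcomplete : CompleteSpace (bergmanSubmodule D) :=
    (isClosed_bergmanSubmodule hD).completeSpace_coe
  suffices h : ∀ w : CSpace n, ∃ k : CSpace n → ℂ, w ∈ D → k ∈ bergmanSpace D ∧
      ∀ f ∈ bergmanSpace D, f w = ∫ z in D, f z * conj (k z) by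
    choose k hk using h
    exact ⟨fun z w => k w z, hk⟩
  intro w
  by_cases hw : w ∈ D
  swap
  · exact ⟨0, fun h => absurd h hw⟩
  obtain ⟨r, hr, hball⟩ := Metric.isOpen_iff.1 hD w hw
  have hrep : ∀ F : bergmanSubmodule D, ∃ f : CSpace n → ℂ, DifferentiableOn ℂ f D ∧
      (F : Lp ℂ 2 (volume.restrict D)) =ᵐ[volume.restrict D] f := fun F => F.2
  choose ρ hρd hρ using hrep
  -- Continuity makes the value at `w` independent of the chosen holomorphic representative, which
  -- gives linearity of evaluation.
  have huniq : ∀ {f g : CSpace n → ℂ}, DifferentiableOn ℂ f D → DifferentiableOn ℂ g D →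
      f =ᵐ[volume.restrict D] g → f w = g w := fun hf hg h =>
    Measure.eqOn_open_of_ae_eq h hD hf.continuousOn hg.continuousOn hw
  let ev : bergmanSubmodule D →ₗ[ℂ] ℂ :=
    { toFun := fun F => ρ F w
      map_add' := fun F G => huniq (hρd _) ((hρd F).add (hρd G))
        ((hρ _).symm.trans ((Lp.coeFn_add _ _).trans ((hρ F).add (hρ G))))
      map_smul' := fun c F => huniq (hρd _) ((hρd F).const_smul c)
        ((hρ _).symm.trans ((Lp.coeFn_smul _ _).trans ((hρ F).const_smul c))) }
  let ev' : bergmanSubmodule D →L[ℂ] ℂ := ev.mkContinuous _ fun F =>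
    norm_apply_le_of_ball_subset hr hball (hρd F) F (hρ F)
  let k := (InnerProductSpace.toDual ℂ (bergmanSubmodule D)).symm ev'
  refine ⟨ρ k, fun _ => ⟨⟨hρd k, (Lp.memLp _).ae_eq (hρ k)⟩, fun f hf => ?_⟩⟩
  have hfF : hf.2.toLp f =ᵐ[volume.restrict D] f := hf.2.coeFn_toLp
  let F : bergmanSubmodule D := ⟨hf.2.toLp f, f, hf.1, hfF⟩
  have h1 : inner ℂ k F = ev' F := InnerProductSpace.toDual_symm_apply
  have h2 : ev' F = f w := huniq (hρd F) hf.1 ((hρ F).symm.trans hfF)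
  rw [← h2, ← h1, Submodule.coe_inner, L2.inner_def]
  refine integral_congr_ae ?_
  filter_upwards [hfF, hρ k] with x hx hxk
  rw [RCLike.inner_apply, hxk]
  exact congrArg (· * _) hx

theorem isBergmanKernel_bergmanKernel {n : ℕ} {D : Set (CSpace n)} (hD : IsOpen D) :
    IsBergmanKernel D (bergmanKernel D) :=
  Classical.epsilon_spec (exists_isBergmanKernel hD)

/-! ### Extremal properties of the kernel on the diagonal -/

theorem bergmanDiag_eq_integral {n : ℕ} {D : Set (CSpace n)} (hD : IsOpen D) {w : CSpace n}
    (hw : w ∈ D) : bergmanDiag D w = ∫ z in D, ‖bergmanKernel D z w‖ ^ 2 := by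
  obtain ⟨hk, hrep⟩ := isBergmanKernel_bergmanKernel hD w hw
  have h := hrep _ hk
  have h2 : ∀ z, bergmanKernel D z w * conj (bergmanKernel D z w) =
      ((‖bergmanKernel D z w‖ ^ 2 : ℝ) : ℂ) := fun z => by
    rw [Complex.mul_conj, Complex.normSq_eq_norm_sq]
  simp only [h2] at h
  rw [integral_complex_ofReal] at h
  rw [bergmanDiag, h, Complex.ofReal_re]

theorem norm_sq_le_bergmanDiag_mul {n : ℕ} {D : Set (CSpace n)} (hD : IsOpen D) {w : CSpace n}
    (hw : w ∈ D) {f : CSpace n → ℂ} (hf : f ∈ bergmanSpace D) :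
    ‖f w‖ ^ 2 ≤ bergmanDiag D w * ∫ z in D, ‖f z‖ ^ 2 := by
  obtain ⟨hk, hrep⟩ := isBergmanKernel_bergmanKernel hD w hw
  rw [hrep f hf, bergmanDiag_eq_integral hD hw, mul_comm]
  exact norm_integral_mul_conj_sq_le hf.2 hk.2

/-- The pointwise bound is applied to `K(·, w)` itself, whose squared norm is `K(w)`: this reads
`K(w)² vol Q ≤ K(w)`. -/
theorem bergmanDiag_mul_volume_le_one {n : ℕ} {D : Set (CSpace n)} (hD : IsOpen D)
    {w : CSpace n} (hw : w ∈ D) {Q : Set (CSpace n)} (hQ : IsOpen Q) (hbal : Balanced ℂ Q)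
    (hfin : volume Q ≠ ∞) (hwQ : ∀ x ∈ Q, w + x ∈ D) :
    bergmanDiag D w * volume.real Q ≤ 1 := by
  obtain ⟨hk, -⟩ := isBergmanKernel_bergmanKernel hD w hw
  have h := norm_sq_mul_volume_le_of_balanced hQ hbal hfin hk hwQ
  rw [← bergmanDiag_eq_integral hD hw] at h
  have h0 : 0 ≤ bergmanDiag D w := by
    rw [bergmanDiag_eq_integral hD hw]
    exact integral_nonneg fun _ => by positivity
  have h1 : bergmanDiag D w ^ 2 ≤ ‖bergmanKernel D w w‖ ^ 2 := by
    gcongr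
    exact Complex.re_le_norm _
  rcases h0.eq_or_lt with h0 | h0
  · simp [← h0]
  · have := (mul_le_mul_of_nonneg_right h1 (measureReal_nonneg (μ := volume) (s := Q))).trans h
    rw [sq, mul_assoc] at this
    exact (mul_le_iff_le_one_right h0).1 this

/-! ### Upper bounds from the inner model -/

theorem ContinuousLinearMap.det_comp' {n : ℕ} (A B : CSpace n →L[ℂ] CSpace n) :
    (A ∘L B).det = A.det * B.det := by
  simp only [ContinuousLinearMap.det]
  exact LinearMap.det_comp _ _

theorem ContinuousLinearMap.det_smul' {n : ℕ} (c : ℂ) (A : CSpace n →L[ℂ] CSpace n) :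
    (c • A).det = c ^ n * A.det := by
  simp only [ContinuousLinearMap.det, ContinuousLinearMap.toLinearMap_smul]
  simp

theorem bergmanDiag_mul_norm_det_sq_le {n : ℕ} {D : Set (CSpace n)} (hD : IsOpen D)
    {z : CSpace n} (hz : z ∈ D) {U : CSpace n →L[ℂ] CSpace n} (hdet : U.det ≠ 0)
    (hU : ∀ x : CSpace n, ∑ i, ‖x i‖ < 1 → z + U x ∈ D) :
    bergmanDiag D z * (‖U.det‖ ^ 2 * ((2 * Real.pi) ^ n / (2 * n).factorial)) ≤ 1 := by
  set Q : Set (CSpace n) := {x | ∑ i, ‖x i‖ < 1} with hQ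
  have hQo : IsOpen Q := isOpen_lt (by fun_prop) (by fun_prop)
  have hQb : Balanced ℂ Q := by
    rw [balanced_iff_smul_mem]
    intro a ha x hx
    refine lt_of_le_of_lt (Finset.sum_le_sum fun i _ => ?_) (show ∑ i, ‖x i‖ < 1 from hx)
    rw [PiLp.smul_apply, norm_smul]
    exact mul_le_of_le_one_left (norm_nonneg _) ha
  have hvol : volume (U '' Q) =
      ENNReal.ofReal (‖U.det‖ ^ 2 * ((2 * Real.pi) ^ n / (2 * n).factorial)) := by
    have := Measure.addHaar_image_continuousLinearMap volume (U.restrictScalars ℝ) Q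
    rw [ContinuousLinearMap.abs_det_restrictScalars, hQ, CSpace.volume_sum_norm_lt_one,
      ← ENNReal.ofReal_mul (by positivity)] at this
    exact this
  have hopen : IsOpen (U '' Q) :=
    (U.toContinuousLinearEquivOfDetNeZero hdet).toHomeomorph.isOpenMap _ hQo
  have hbal : Balanced ℂ (U '' Q) := by
    rw [balanced_iff_smul_mem]
    rintro a ha _ ⟨x, hx, rfl⟩
    exact ⟨a • x, hQb.smul_mem ha hx, map_smul U a x⟩
  have := bergmanDiag_mul_volume_le_one hD hz hopen hbal (by rw [hvol]; exact ENNReal.ofReal_ne_top)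
    (by rintro _ ⟨x, hx, rfl⟩; exact hU x hx)
  rwa [Measure.real, hvol, ENNReal.toReal_ofReal (by positivity)] at this

theorem CSpace.sum_norm_le (n : ℕ) (x : CSpace n) : ∑ i, ‖x i‖ ≤ √n * ‖x‖ := by
  rw [EuclideanSpace.norm_eq, ← Real.sqrt_mul (by positivity)]
  refine Real.le_sqrt_of_sq_le ?_
  simpa using sq_sum_le_card_mul_sum_sq (s := Finset.univ) (f := fun i => ‖x i‖)

theorem norm_inv_sqrt_pow_sq (n : ℕ) : ‖(((√n)⁻¹ : ℝ) : ℂ) ^ n‖ ^ 2 = ((n : ℝ) ^ n)⁻¹ := by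
  rw [norm_pow, Complex.norm_real, Real.norm_of_nonneg (by positivity), ← pow_mul, mul_comm,
    pow_mul, inv_pow, Real.sq_sqrt (by positivity), inv_pow]

/-- The ball shrunk by `√n` fits in the `ℓ¹` ball, so `x ↦ z + U x / √n` is a competitor; the
scaling costs `nⁿ`. -/
theorem kobayashiVol_le {n : ℕ} (hn : 0 < n) {D : Set (CSpace n)} {z : CSpace n}
    {U : CSpace n →L[ℂ] CSpace n} (hdet : U.det ≠ 0)
    (hU : ∀ x : CSpace n, ∑ i, ‖x i‖ < 1 → z + U x ∈ D) :
    kobayashiVol D z ≤ ENNReal.ofReal ((n : ℝ) ^ n / ‖U.det‖ ^ 2) := by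
  have hn' : (0 : ℝ) < √n := Real.sqrt_pos.2 (by exact_mod_cast hn)
  set c : ℂ := (((√n)⁻¹ : ℝ) : ℂ) with hc
  let ψ : CSpace n → CSpace n := fun x => z + (c • U) x
  have hψ : ψ ∈ {ψ ∈ HolMaps (Metric.ball 0 1) D | ψ 0 = z} := by
    refine ⟨⟨by simp only [ψ]; fun_prop, fun x hx => ?_⟩, by simp [ψ]⟩
    have : (c • U) x = U (c • x) := by simp
    simp only [ψ, this]
    refine hU _ ?_
    rw [mem_ball_zero_iff] at hx
    refine (CSpace.sum_norm_le n _).trans_lt ?_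
    rw [norm_smul, hc, Complex.norm_real, Real.norm_of_nonneg (by positivity), ← mul_assoc,
      mul_inv_cancel₀ hn'.ne', one_mul]
    exact hx
  have hder : fderiv ℂ ψ 0 = c • U := by
    simp only [ψ, fderiv_const_add]
    exact (c • U).fderiv
  refine (iInf₂_le ψ hψ).trans_eq ?_
  have hUpos : 0 < ‖U.det‖ := norm_pos_iff.2 hdet
  have hn0 : (0 : ℝ) < n := by exact_mod_cast hn
  rw [hder, ContinuousLinearMap.det_smul', ← ofReal_norm, ← ENNReal.ofReal_pow (norm_nonneg _),
    norm_mul, mul_pow, norm_inv_sqrt_pow_sq, ← ENNReal.ofReal_inv_of_pos (by positivity)]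
  congr 1
  field_simp

/-! ### Lower bounds from the outer model by the Cayley map -/

/-- The componentwise product with a vector, as a linear endomorphism of `ℂⁿ`. -/
noncomputable def CSpace.diagonal {n : ℕ} (c : Fin n → ℂ) : CSpace n →L[ℂ] CSpace n :=
  ((PiLp.continuousLinearEquiv 2 ℂ (fun _ : Fin n => ℂ)).symm : (Fin n → ℂ) →L[ℂ] CSpace n) ∘L
    ContinuousLinearMap.pi fun j => c j • (EuclideanSpace.proj j : CSpace n →L[ℂ] ℂ)

theorem CSpace.diagonal_apply {n : ℕ} (c : Fin n → ℂ) (x : CSpace n) (j : Fin n) :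
    CSpace.diagonal c x j = c j * x j := rfl

theorem CSpace.det_diagonal {n : ℕ} (c : Fin n → ℂ) : (CSpace.diagonal c).det = ∏ j, c j := by
  classical
  rw [ContinuousLinearMap.det,
    ← LinearMap.det_toMatrix (EuclideanSpace.basisFun (Fin n) ℂ).toBasis]
  have : LinearMap.toMatrix (EuclideanSpace.basisFun (Fin n) ℂ).toBasis
      (EuclideanSpace.basisFun (Fin n) ℂ).toBasis (CSpace.diagonal c : CSpace n →ₗ[ℂ] CSpace n) =
      Matrix.diagonal c := by
    ext i j
    by_cases h : i = j
    · subst h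
      simp [LinearMap.toMatrix_apply, CSpace.diagonal_apply]
    · simp [LinearMap.toMatrix_apply, CSpace.diagonal_apply, h]
  rw [this, Matrix.det_diagonal]

/-- The map `x ↦ (yⱼ / (2 - yⱼ))ⱼ` with `y = Λ (x - z)`, which sends the product of half-planes
`Re yⱼ < 1` biholomorphically to the unit polydisc. -/
noncomputable def cayleyMap {n : ℕ} (z : CSpace n) (Λ : CSpace n →L[ℂ] CSpace n)
    (x : CSpace n) : CSpace n :=
  WithLp.toLp 2 fun j => Λ (x - z) j / (2 - Λ (x - z) j)

section Cayley

variable {n : ℕ} {D : Set (CSpace n)} {z : CSpace n} {Λ : CSpace n →L[ℂ] CSpace n}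

theorem two_sub_ne_zero_of_re_lt_one {t : ℂ} (ht : t.re < 1) : 2 - t ≠ 0 := by
  intro h
  have := congrArg Complex.re h
  simp at this
  linarith

theorem hasDerivAt_div_two_sub {t : ℂ} (ht : 2 - t ≠ 0) :
    HasDerivAt (fun s : ℂ => s / (2 - s)) (2 / (2 - t) ^ 2) t := by
  have := (hasDerivAt_id t).fun_div ((hasDerivAt_id t).const_sub 2) ht
  simpa using this

theorem norm_cayleyMap_apply_lt_one (hΛ : ∀ x ∈ D, ∀ j, (Λ (x - z) j).re < 1) {x : CSpace n}
    (hx : x ∈ D) (j : Fin n) : ‖cayleyMap z Λ x j‖ < 1 := by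
  have h := hΛ x hx j
  change ‖Λ (x - z) j / (2 - Λ (x - z) j)‖ < 1
  generalize Λ (x - z) j = t at h
  rw [norm_div, div_lt_one (norm_pos_iff.2 (two_sub_ne_zero_of_re_lt_one h))]
  -- After squaring, `|t|² < |2 - t|²` is exactly `Re t < 1`.
  refine lt_of_pow_lt_pow_left₀ 2 (norm_nonneg _) ?_
  rw [← Complex.normSq_eq_norm_sq, ← Complex.normSq_eq_norm_sq, Complex.normSq_apply,
    Complex.normSq_apply]
  simp only [Complex.sub_re, Complex.sub_im, Complex.re_ofNat, Complex.im_ofNat]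
  nlinarith

theorem cayleyMap_self : cayleyMap z Λ z = 0 := by
  ext j
  simp [cayleyMap]

theorem hasFDerivAt_cayleyMap (hΛ : ∀ x ∈ D, ∀ j, (Λ (x - z) j).re < 1) {x : CSpace n}
    (hx : x ∈ D) : HasFDerivAt (cayleyMap z Λ)
      (CSpace.diagonal (fun j => 2 / (2 - Λ (x - z) j) ^ 2) ∘L Λ) x := by
  rw [← hasFDerivWithinAt_univ, hasFDerivWithinAt_euclidean]
  intro j
  have hne := two_sub_ne_zero_of_re_lt_one (hΛ x hx j)
  have h2 : HasFDerivAt (fun x : CSpace n => Λ (x - z) j)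
      ((EuclideanSpace.proj j : CSpace n →L[ℂ] ℂ) ∘L Λ) x := by
    have := (((EuclideanSpace.proj j : CSpace n →L[ℂ] ℂ) ∘L Λ).hasFDerivAt (x := x - z)).comp x
      (hasFDerivAt_sub_const z)
    rwa [ContinuousLinearMap.comp_id] at this
  exact ((hasDerivAt_div_two_sub hne).comp_hasFDerivAt x h2).hasFDerivWithinAt

theorem injOn_cayleyMap (hΛ : ∀ x ∈ D, ∀ j, (Λ (x - z) j).re < 1) (hdet : Λ.det ≠ 0) :
    Set.InjOn (cayleyMap z Λ) D := by
  intro x hx y hy hxy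
  have hinj : Function.Injective Λ := (Λ.toContinuousLinearEquivOfDetNeZero hdet).injective
  have : Λ (x - z) = Λ (y - z) := by
    ext j
    have h := congrArg (fun v : CSpace n => v j) hxy
    change Λ (x - z) j / (2 - Λ (x - z) j) = Λ (y - z) j / (2 - Λ (y - z) j) at h
    rw [div_eq_div_iff (two_sub_ne_zero_of_re_lt_one (hΛ x hx j))
      (two_sub_ne_zero_of_re_lt_one (hΛ y hy j))] at h
    linear_combination h / 2
  simpa using hinj this

/-- The test function is the Jacobian determinant of the Cayley map. By injectivity its squared `L²`
norm is the volume of the image, at most that of the polydisc; at `z` each coordinate contributes a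
factor `1/2`, whence `4ⁿ`. -/
theorem norm_det_sq_le_bergmanDiag (hD : IsOpen D) (hz : z ∈ D)
    (hΛ : ∀ x ∈ D, ∀ j, (Λ (x - z) j).re < 1) (hdet : Λ.det ≠ 0) :
    ‖Λ.det‖ ^ 2 / 4 ^ n ≤ bergmanDiag D z * Real.pi ^ n := by
  let f : CSpace n → ℂ := fun x => (∏ j, 2 / (2 - Λ (x - z) j) ^ 2) * Λ.det
  have hfd : DifferentiableOn ℂ f D := by
    classical
    intro x hx
    have hj : ∀ j ∈ Finset.univ, DifferentiableAt ℂ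
        (fun x : CSpace n => 2 / (2 - Λ (x - z) j) ^ 2) x := fun j _ => by
      have hne : (2 - Λ (x - z) j) ^ 2 ≠ 0 :=
        pow_ne_zero 2 (two_sub_ne_zero_of_re_lt_one (hΛ x hx j))
      have hd : DifferentiableAt ℂ (fun x : CSpace n => (2 - Λ (x - z) j) ^ 2) x := by fun_prop
      simp only [div_eq_mul_inv]
      exact (hd.fun_inv hne).const_mul 2
    exact ((HasFDerivAt.finsetProd fun j h => (hj j h).hasFDerivAt).mul_const
      Λ.det).differentiableAt.differentiableWithinAt
  have hlint : ∫⁻ x in D, ENNReal.ofReal (‖f x‖ ^ 2) ≤ ENNReal.ofReal (Real.pi ^ n) := by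
    have h := lintegral_image_eq_lintegral_abs_det_fderiv_mul volume hD.measurableSet
      (fun x hx => ((hasFDerivAt_cayleyMap hΛ hx).restrictScalars ℝ).hasFDerivWithinAt)
      (injOn_cayleyMap hΛ hdet) (fun _ => 1)
    simp only [ContinuousLinearMap.abs_det_restrictScalars, ContinuousLinearMap.det_comp',
      CSpace.det_diagonal, mul_one, setLIntegral_one] at h
    rw [← h, ← CSpace.volume_polydisc]
    refine measure_mono ?_
    rintro _ ⟨x, hx, rfl⟩ j
    exact norm_cayleyMap_apply_lt_one hΛ hx j
  have hmeas : AEStronglyMeasurable f (volume.restrict D) :=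
    hfd.continuousOn.aestronglyMeasurable hD.measurableSet
  have hint : Integrable (fun x => ‖f x‖ ^ 2) (volume.restrict D) := by
    refine ⟨(hmeas.norm.pow 2), ?_⟩
    rw [hasFiniteIntegral_iff_ofReal (Filter.Eventually.of_forall fun _ => by positivity)]
    exact hlint.trans_lt ENNReal.ofReal_lt_top
  have hf : f ∈ bergmanSpace D := ⟨hfd, (memLp_two_iff_integrable_sq_norm hmeas).2 hint⟩
  have hle : ∫ x in D, ‖f x‖ ^ 2 ≤ Real.pi ^ n := by
    rw [← ENNReal.ofReal_le_ofReal_iff (by positivity), ofReal_integral_eq_lintegral_ofReal hint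
      (Filter.Eventually.of_forall fun _ => by positivity)]
    exact hlint
  have hfz : ‖f z‖ ^ 2 = ‖Λ.det‖ ^ 2 / 4 ^ n := by
    simp only [f, sub_self, map_zero, PiLp.zero_apply, sub_zero, Finset.prod_const,
      Finset.card_univ, Fintype.card_fin, norm_mul, norm_pow, norm_div, mul_pow]
    rw [← pow_mul, mul_comm n 2, pow_mul]
    norm_num
    rw [one_div_pow, mul_comm, mul_one_div]
  rw [← hfz]
  refine (norm_sq_le_bergmanDiag_mul hD hz hf).trans ?_
  gcongr
  rw [bergmanDiag_eq_integral hD hz]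
  exact integral_nonneg fun _ => by positivity

/-- The polydisc lies in the ball of radius `√n`, so the Cayley map divided by `√n` is a competitor.
-/
theorem le_caratheodoryVol (hn : 0 < n) (hz : z ∈ D)
    (hΛ : ∀ x ∈ D, ∀ j, (Λ (x - z) j).re < 1) :
    ENNReal.ofReal (‖Λ.det‖ ^ 2 / (4 ^ n * (n : ℝ) ^ n)) ≤ caratheodoryVol D z := by
  have hn0 : (0 : ℝ) < n := by exact_mod_cast hn
  have hn' : (0 : ℝ) < √n := Real.sqrt_pos.2 hn0
  set c : ℂ := (((√n)⁻¹ : ℝ) : ℂ) with hc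
  let ψ : CSpace n → CSpace n := fun x => c • cayleyMap z Λ x
  have hψ : ψ ∈ {ψ ∈ HolMaps D (Metric.ball 0 1) | ψ z = 0} := by
    refine ⟨⟨fun x hx => ?_, fun x hx => ?_⟩, by simp [ψ, cayleyMap_self]⟩
    · exact ((hasFDerivAt_cayleyMap hΛ hx).const_smul c).differentiableAt.differentiableWithinAt
    · rw [mem_ball_zero_iff]
      simp only [ψ, norm_smul, hc, Complex.norm_real]
      rw [Real.norm_of_nonneg (by positivity), inv_mul_lt_one₀ hn', EuclideanSpace.norm_eq]
      refine Real.sqrt_lt_sqrt (Finset.sum_nonneg fun _ _ => by positivity) ?_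
      have : Nonempty (Fin n) := ⟨⟨0, hn⟩⟩
      calc ∑ j, ‖cayleyMap z Λ x j‖ ^ 2 < ∑ _j : Fin n, (1 : ℝ) :=
            Finset.sum_lt_sum_of_nonempty Finset.univ_nonempty fun j _ =>
              pow_lt_one₀ (norm_nonneg _) (norm_cayleyMap_apply_lt_one hΛ hx j) two_ne_zero
        _ = n := by simp
  refine le_trans (le_of_eq ?_) (le_iSup₂ (f := fun (ψ : CSpace n → CSpace n)
    (_ : ψ ∈ {ψ ∈ HolMaps D (Metric.ball 0 1) | ψ z = 0}) => ‖(fderiv ℂ ψ z).det‖ₑ ^ 2) ψ hψ)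
  have hder : fderiv ℂ ψ z = _ := ((hasFDerivAt_cayleyMap hΛ hz).const_smul c).fderiv
  rw [hder, ContinuousLinearMap.det_smul', ContinuousLinearMap.det_comp', CSpace.det_diagonal,
    ← ofReal_norm, ← ENNReal.ofReal_pow (norm_nonneg _), norm_mul, mul_pow, norm_inv_sqrt_pow_sq]
  congr 1
  simp only [sub_self, map_zero, PiLp.zero_apply, sub_zero, Finset.prod_const,
    Finset.card_univ, Fintype.card_fin, norm_mul, norm_pow, norm_div, mul_pow]
  rw [← pow_mul (_ / _) n 2, mul_comm n 2, pow_mul]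
  norm_num
  rw [one_div_pow]
  field_simp

end Cayley

/-! ### Assembling the constants -/

theorem natCast_le_four_pow_sub_one_div_three (n : ℕ) : (n : ℝ) ≤ (4 ^ n - 1) / 3 := by
  have := one_add_mul_le_pow (show (-2 : ℝ) ≤ 3 by norm_num) n
  norm_num at this
  linarith

theorem mainTheorem5 (n : ℕ) (hn : 2 ≤ n) (D : Set (CSpace n)) (hopen : IsOpen D)
    (hconv : Convex ℝ D) (hnd : NonDegenerate D) :
    IsBergmanKernel D (bergmanKernel D) ∧
    ∀ z ∈ D,
      (ENNReal.ofReal (Real.pi ^ n / (((2 * n).factorial : ℝ) * (2 * (n : ℝ)) ^ n)) ≤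
          caratheodoryVol D z / ENNReal.ofReal (bergmanDiag D z) ∧
        caratheodoryVol D z / ENNReal.ofReal (bergmanDiag D z) ≤
          ENNReal.ofReal ((4 * Real.pi * (4 ^ n - 1) / 3) ^ n)) ∧
      (ENNReal.ofReal (Real.pi ^ n / (((2 * n).factorial : ℝ) * (2 * (n : ℝ)) ^ n)) ≤
          kobayashiVol D z / ENNReal.ofReal (bergmanDiag D z) ∧
        kobayashiVol D z / ENNReal.ofReal (bergmanDiag D z) ≤
          ENNReal.ofReal ((4 * Real.pi * (4 ^ n - 1) / 3) ^ n)) := by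
  refine ⟨isBergmanKernel_bergmanKernel hopen, fun z hz => ?_⟩
  have hn0 : 0 < n := by omega
  have hnR : (0 : ℝ) < n := by exact_mod_cast hn0
  obtain ⟨U, Λ, hU, hΛ, hdet⟩ := exists_inner_and_outer_linear_maps hopen hconv hnd hz
  have hU0 : U.det ≠ 0 := right_ne_zero_of_mul_eq_one hdet
  have hΛ0 : Λ.det ≠ 0 := left_ne_zero_of_mul_eq_one hdet
  have ha : 0 < ‖U.det‖ ^ 2 := by positivity
  have hΛa : ‖Λ.det‖ ^ 2 = (‖U.det‖ ^ 2)⁻¹ := by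
    rw [← inv_pow, ← norm_inv, eq_inv_of_mul_eq_one_left hdet]
  have hKup := bergmanDiag_mul_norm_det_sq_le hopen hz hU0 hU
  have hKlow := norm_det_sq_le_bergmanDiag hopen hz hΛ hΛ0
  have hc := le_caratheodoryVol hn0 hz hΛ
  have hk := kobayashiVol_le hn0 hU0 hU
  have hck := caratheodoryVol_le_kobayashiVol hopen hz
  rw [hΛa] at hKlow hc
  generalize ‖U.det‖ ^ 2 = a at *
  generalize bergmanDiag D z = κ at *
  have hpi := Real.pi_pos
  have hκ : 0 < κ := by
    have : 0 < κ * Real.pi ^ n := lt_of_lt_of_le (by positivity) hKlow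
    exact pos_of_mul_pos_left this (by positivity)
  have hκ' : ENNReal.ofReal κ ≠ 0 := (ENNReal.ofReal_pos.2 hκ).ne'
  have hfac : (0 : ℝ) < (2 * n).factorial := by exact_mod_cast Nat.factorial_pos _
  have hlower : ENNReal.ofReal (Real.pi ^ n / (((2 * n).factorial : ℝ) * (2 * (n : ℝ)) ^ n)) ≤
      caratheodoryVol D z / ENNReal.ofReal κ := by
    rw [ENNReal.le_div_iff_mul_le (.inl hκ') (.inl ENNReal.ofReal_ne_top),
      ← ENNReal.ofReal_mul (by positivity)]
    refine le_trans (ENNReal.ofReal_le_ofReal ?_) hc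
    have h4 : (4 : ℝ) ^ n = 2 ^ n * 2 ^ n := by rw [← mul_pow]; norm_num
    -- The first factor is the quantity bounded by `1` in `hKup`, the second the lower bound `hc`;
    -- the powers of two combine as `2ⁿ / 4ⁿ = 1 / 2ⁿ`.
    calc Real.pi ^ n / ((2 * n).factorial * (2 * (n : ℝ)) ^ n) * κ
        = κ * (a * ((2 * Real.pi) ^ n / (2 * n).factorial)) * (a⁻¹ / (4 ^ n * (n : ℝ) ^ n)) := by
          rw [h4, mul_pow, mul_pow]
          field_simp
      _ ≤ 1 * (a⁻¹ / (4 ^ n * (n : ℝ) ^ n)) := by gcongr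
      _ = _ := one_mul _
  have hupper : kobayashiVol D z / ENNReal.ofReal κ ≤
      ENNReal.ofReal ((4 * Real.pi * (4 ^ n - 1) / 3) ^ n) := by
    have hnum := natCast_le_four_pow_sub_one_div_three n
    refine ENNReal.div_le_of_le_mul (hk.trans ?_)
    rw [mul_div_assoc, ← ENNReal.ofReal_mul (pow_nonneg (mul_nonneg (by positivity)
      (hnR.le.trans hnum)) n)]
    refine ENNReal.ofReal_le_ofReal ?_
    calc (n : ℝ) ^ n / a = a⁻¹ / 4 ^ n * (4 ^ n * (n : ℝ) ^ n) := by field_simp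
      _ ≤ κ * Real.pi ^ n * (4 ^ n * (n : ℝ) ^ n) := by gcongr
      _ = (4 * Real.pi * n) ^ n * κ := by rw [mul_pow, mul_pow]; ring
      _ ≤ _ := by gcongr
  have hmono : caratheodoryVol D z / ENNReal.ofReal κ ≤ kobayashiVol D z / ENNReal.ofReal κ :=
    ENNReal.div_le_div_right hck _
  exact ⟨⟨hlower, hmono.trans hupper⟩, hlower.trans hmono, hupper⟩
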